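/- Let $n\ge 0$ and let $F:\mathbb{R}^n\times\mathbb{R}^n\to\mathbb{R}^n$ be a $C^\infty$ map. Then the autonomous system of second-order ordinary differential equations $$\ddot x^i=F^i(x,\dot x),\qquad i=1,\dots,n,$$ admits a (local) superposition rule, in the following sense. There exist an integer $m\ge 0$, an open dense set $U\subseteq \mathrm{T}\mathbb{R}^{mn}\simeq\mathbb{R}^{mn}\times\mathbb{R}^{mn}$, an open set $D\subseteq \mathrm{T}\mathbb{R}^{mn}\times\mathbb{R}^{2n}$ and a map $\Psi$ to $\mathbb{R}^n$, defined and of class $C^\infty$ on $D$ and not depending on the time, such that the following holds for every open interval $I$ containing $0$ and every family $x_1(t),\dots,x_m(t)$ of solutions of the system on $I$ that is generic, i.e. for which $p(t):=(x_1(t),\dots,x_m(t),\dot x_1(t),\dots,\dot x_m(t))$ lies in $U$ for all $t\in I$ (if $p(0)\in U$, this holds after shrinking $I$): 1. for every solution $x(t)$ of the system on $I$ there are constants $\lambda=(\lambda_1,\dots,\lambda_{2n})\in\mathbb{R}^{2n}$ such that, for all $t\in I$, $(p(t),\lambda)\in D$ and $$x(t)=\Psi\bigl(x_1(t),\dots,x_m(t),\dot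 x_1(t),\dots,\dot x_m(t);\lambda_1,\dots,\lambda_{2n}\bigr);$$ 2. conversely, for all $\lambda\in\mathbb{R}^{2n}$ with $(p(t),\lambda)\in D$ for all $t\in I$, the curve $t\mapsto\Psi(p(t);\lambda)$ is a solution of the system on $I$. -/

import Mathlib

open scoped ContDiff

/-- The tangent bundle `T ℝ^{mn}`, in its global trivialisation: a point is a pair
`((x₁, …, x_m), (v₁, …, v_m))` with all `x_a, v_a ∈ ℝⁿ`. -/
abbrev TangentPower (n m : ℕ) : Type :=
  (Fin m → Fin n → ℝ) × (Fin m → Fin n → ℝ)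

/-- `x` is a solution of the system `ẍ = F (t, x, ẋ)` on the (open) set of times `I`:
at each `t ∈ I` it is twice differentiable and satisfies the equation. -/
def IsSODESolutionOn {n : ℕ} (F : ℝ → (Fin n → ℝ) → (Fin n → ℝ) → (Fin n → ℝ))
    (x : ℝ → Fin n → ℝ) (I : Set ℝ) : Prop :=
  ∀ t ∈ I, DifferentiableAt ℝ x t ∧ HasDerivAt (deriv x) (F t (x t) (deriv x t)) t

/-- The curve `t ↦ (x₁ t, …, x_m t, ẋ₁ t, …, ẋ_m t)` in `T ℝ^{mn}` of a family of curves. -/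
noncomputable def familyLift {n m : ℕ} (x : Fin m → ℝ → Fin n → ℝ) (t : ℝ) :
    TangentPower n m :=
  (fun a => x a t, fun a => deriv (x a) t)

/-- `x₁, …, x_m` is a family of particular solutions on `I` which is generic with respect to `U`:
`I` is an open interval around the initial time `0`, and `(x_a, ẋ_a)` lies in `U` at time `0` and
throughout `I`. -/
structure IsGenericFamily {n m : ℕ} (F : ℝ → (Fin n → ℝ) → (Fin n → ℝ) → (Fin n → ℝ))
    (U : Set (TangentPower n m)) (I : Set ℝ) (x : Fin m → ℝ → Fin n → ℝ) : Prop where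
  isOpen : IsOpen I
  ordConnected : I.OrdConnected
  zero_mem : (0 : ℝ) ∈ I
  solution : ∀ a, IsSODESolutionOn F (x a) I
  lift_mem : ∀ t ∈ I, familyLift x t ∈ U

/-- `Ψ`, a map to `ℝⁿ` that is defined and smooth on the open set `D ⊆ T ℝ^{mn} × ℝ^{2n}`, is a
superposition rule for `ẍ = F (t, x, ẋ)`, valid for the families that are generic with respect to
the open dense set `U ⊆ T ℝ^{mn}`. -/
structure IsSuperpositionRule {n m : ℕ} (F : ℝ → (Fin n → ℝ) → (Fin n → ℝ) → (Fin n → ℝ))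
    (U : Set (TangentPower n m)) (D : Set (TangentPower n m × (Fin (2 * n) → ℝ)))
    (Ψ : TangentPower n m × (Fin (2 * n) → ℝ) → Fin n → ℝ) : Prop where
  isOpen : IsOpen U
  dense : Dense U
  isOpen_dom : IsOpen D
  smooth : ContDiffOn ℝ ∞ Ψ D
  /-- Every solution is obtained from the particular solutions and some value of the constants. -/
  exists_constants : ∀ (I : Set ℝ) (x : Fin m → ℝ → Fin n → ℝ), IsGenericFamily F U I x →
    ∀ y : ℝ → Fin n → ℝ, IsSODESolutionOn F y I →
      ∃ k : Fin (2 * n) → ℝ,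
        ∀ t ∈ I, (familyLift x t, k) ∈ D ∧ y t = Ψ (familyLift x t, k)
  /-- Every value of the constants yields a solution (where the expression is defined). -/
  solution_of_constants : ∀ (I : Set ℝ) (x : Fin m → ℝ → Fin n → ℝ), IsGenericFamily F U I x →
    ∀ k : Fin (2 * n) → ℝ, (∀ t ∈ I, (familyLift x t, k) ∈ D) →
      IsSODESolutionOn F (fun t => Ψ (familyLift x t, k)) I

/-- The system `ẍ = F (t, x, ẋ)` on `ℝⁿ` admits a superposition rule, depending on some number
`m` of particular solutions. -/
def AdmitsSuperpositionRule {n : ℕ}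
    (F : ℝ → (Fin n → ℝ) → (Fin n → ℝ) → (Fin n → ℝ)) : Prop :=
  ∃ (m : ℕ) (U : Set (TangentPower n m)) (D : Set (TangentPower n m × (Fin (2 * n) → ℝ)))
    (Ψ : TangentPower n m × (Fin (2 * n) → ℝ) → Fin n → ℝ), IsSuperpositionRule F U D Ψ

/-!
The solutions of `ẍ = F (x, ẋ)` are the integral curves of the single vector field
`X (x, v) = (v, F x v)` on `ℝⁿ × ℝⁿ`, and one particular solution (`m = 1`) suffices to express all
the others: it serves as a clock. Suppose that `τ` is a smooth function with `dτ (X) = 1` on an open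
dense set `U`, a *time function*. Along a solution `p (t)` in `U` one has `τ (p t) = t + a`, so that for a fixed `μ` the
curve `t ↦ flow X (τ (p t), μ)` is an integral curve of `X`, and its position part is a solution
of the system.

* `U` and `τ` come from the local straightening of `X` (`exists_isTimeFunctionOn`), which works
  wherever `X ≠ 0`, in particular wherever `v ≠ 0`. No compatibility between the local time
  functions is needed: `U` is the union of a maximal disjoint family of their domains
  (`exists_dense_isTimeFunctionOn`).
* `X` need not be complete, so a given solution `y` may not exist at the instant where `τ ∘ p` is
  `0`. It does exist at some instant where `τ ∘ p` takes a value `q j` of a fixed dense sequence,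
  and `y t = flow X (τ (p t) - q j, μ)` for the value `μ` of `(y, ẏ)` at that instant. The constants
  must therefore record `j ∈ ℕ` and `μ ∈ ℝ²ⁿ`; for this, countably many copies of `ℝ²ⁿ` are placed
  in `ℝ²ⁿ` as the slabs `j < k₀ < j + 1` (`decode`).
* The rule is smooth because the flow of a smooth vector field is smooth on an open domain that
  contains every integral curve (`contDiffOn_flow`, `mem_flowDomain_of_hasDerivAt`). Locally
  (`exists_isLocalFlow`) this is the inverse function theorem for the integral equation
  `f u = x + t ∫₀ᵘ X (f v) dv` on the Banach space `C([0, 1], E)`, where `f ↦ X ∘ f` is smooth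
  (`contDiff_continuousMap_comp`); the time `t` is a parameter of the equation, so that smoothness
  in `t` and in `x` comes at once. Local flows are then composed along a trajectory.
-/

/-! ### Smoothness of the composition operator on spaces of continuous maps -/

section Composition

open Set Filter Topology

universe u

/-- Pointwise application of a continuous family of operators, as a continuous linear map
`C(K, E →L F) → (C(K, E) →L C(K, F))`. -/
noncomputable def pointwiseApply (K : Type*) [TopologicalSpace K] [CompactSpace K]
    (E F : Type*) [NormedAddCommGroup E] [NormedSpace ℝ E]
    [NormedAddCommGroup F] [NormedSpace ℝ F] :
    C(K, E →L[ℝ] F) →L[ℝ] C(K, E) →L[ℝ] C(K, F) :=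
  LinearMap.mkContinuous₂
    (LinearMap.mk₂ ℝ (fun (A : C(K, E →L[ℝ] F)) (h : C(K, E)) =>
        (⟨fun t => A t (h t), by fun_prop⟩ : C(K, F)))
      (fun A B h => by ext t; simp) (fun c A h => by ext t; simp)
      (fun A h k => by ext t; simp) (fun c A h => by ext t; simp)) 1
    (fun A h => by
      rw [ContinuousMap.norm_le _ (by positivity)]
      intro t
      simp only [LinearMap.mk₂_apply, ContinuousMap.coe_mk, one_mul]
      exact ((A t).le_opNorm (h t)).trans
        (mul_le_mul (A.norm_coe_le_norm t) (h.norm_coe_le_norm t) (norm_nonneg _)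
          ((norm_nonneg (A t)).trans (A.norm_coe_le_norm t))))

variable {K : Type*} [TopologicalSpace K] [CompactSpace K]

lemma hasFDerivAt_continuousMap_comp {E F : Type*} [NormedAddCommGroup E] [NormedSpace ℝ E]
    [NormedAddCommGroup F] [NormedSpace ℝ F] (X : C(E, F)) (X' : C(E, E →L[ℝ] F))
    (hX : ∀ x, HasFDerivAt X (X' x) x) (f : C(K, E)) :
    HasFDerivAt (fun g : C(K, E) => X.comp g) (pointwiseApply K E F (X'.comp f)) f := by
  rw [hasFDerivAt_iff_isLittleO_nhds_zero, Asymptotics.isLittleO_iff]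
  intro c hc
  have hcont : ContinuousAt (fun g : C(K, E) => X'.comp g) f :=
    (ContinuousMap.continuous_postcomp X').continuousAt
  obtain ⟨δ, hδ, hball⟩ :=
    (Metric.continuousAt_iff (α := C(K, E)) (β := C(K, E →L[ℝ] F))).1 hcont c hc
  filter_upwards [Metric.ball_mem_nhds (0 : C(K, E)) hδ] with h hh
  rw [ContinuousMap.norm_le _ (by positivity)]
  intro t
  -- The mean value inequality on the segment from `f t` to `f t + h t`; its points are of the
  -- form `g t` with `g = f + s • h` uniformly close to `f`.
  have key := Convex.norm_image_sub_le_of_norm_hasFDerivWithin_le' (𝕜 := ℝ)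
    (s := segment ℝ (f t) (f t + h t)) (f := X) (f' := fun x => X' x) (φ := X' (f t)) (C := c)
    (fun x _ => (hX x).hasFDerivWithinAt) (fun x hx => ?_) (convex_segment _ _)
    (left_mem_segment ℝ _ _) (right_mem_segment ℝ _ _)
  · simp only [add_sub_cancel_left] at key
    exact key.trans (by gcongr; exact h.norm_coe_le_norm t)
  · rw [segment_eq_image'] at hx
    obtain ⟨s, hs, rfl⟩ := hx
    have hd : dist (f + s • h) f < δ := by
      rw [dist_eq_norm, add_sub_cancel_left, norm_smul, Real.norm_of_nonneg hs.1]
      have : ‖h‖ < δ := by simpa using hh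
      nlinarith [hs.2, norm_nonneg h]
    have := (ContinuousMap.dist_lt_iff hc).1 (hball hd) t
    rw [dist_eq_norm] at this
    simpa using this.le

/-- Composition with a smooth map is a smooth operation on continuous maps on a compact space.
The derivative is again built from composition operators, which gives the induction. -/
lemma contDiff_continuousMap_comp {E F : Type u} [NormedAddCommGroup E] [NormedSpace ℝ E]
    [NormedAddCommGroup F] [NormedSpace ℝ F] (X : C(E, F)) (hX : ContDiff ℝ ∞ X) :
    ContDiff ℝ ∞ (fun g : C(K, E) => X.comp g) := by
  rw [contDiff_infty]
  intro n
  induction n generalizing F with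
  | zero => exact contDiff_zero.2 (ContinuousMap.continuous_postcomp X)
  | succ n ih =>
    have hX' : ContDiff ℝ ∞ (fderiv ℝ X) := (contDiff_infty_iff_fderiv.1 hX).2
    let X' : C(E, E →L[ℝ] F) := ⟨fderiv ℝ X, hX'.continuous⟩
    have := ih X' hX'
    rw [Nat.cast_succ, contDiff_succ_iff_hasFDerivAt]
    refine ⟨fun g => pointwiseApply K E F (X'.comp g),
      this.continuousLinearMap_comp (pointwiseApply K E F), fun g => ?_⟩
    exact hasFDerivAt_continuousMap_comp X X'
      (fun x => ((hX.differentiable (by simp)) x).hasFDerivAt) g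

end Composition

/-! ### Primitives as a bounded operator -/

section Primitive

open Set MeasureTheory unitInterval

/-- The operator sending a continuous map `f` on the unit interval to its primitive
`u ↦ ∫₀ᵘ f`. -/
noncomputable def primitiveCLM (E : Type*) [NormedAddCommGroup E] [NormedSpace ℝ E] :
    C(I, E) →L[ℝ] C(I, E) :=
  LinearMap.mkContinuous
    { toFun := fun f => ⟨fun u => ∫ v in (0 : ℝ)..u, IccExtend zero_le_one f v, by
        have : Continuous fun u : ℝ => ∫ v in (0 : ℝ)..u, IccExtend zero_le_one f v :=
          intervalIntegral.continuous_primitive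
            (fun a b => (f.continuous.Icc_extend').intervalIntegrable a b) 0
        exact this.comp continuous_subtype_val⟩
      map_add' := fun f g => by
        ext u
        simp only [ContinuousMap.coe_mk, ContinuousMap.add_apply]
        rw [← intervalIntegral.integral_add
          ((f.continuous.Icc_extend').intervalIntegrable _ _)
          ((g.continuous.Icc_extend').intervalIntegrable _ _)]
        rfl
      map_smul' := fun c f => by
        ext u
        simp only [ContinuousMap.coe_mk, ContinuousMap.smul_apply, RingHom.id_apply]
        rw [← intervalIntegral.integral_smul]
        rfl } 1
    (fun f => by
      rw [ContinuousMap.norm_le _ (by positivity)]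
      intro u
      simp only [LinearMap.coe_mk, AddHom.coe_mk, ContinuousMap.coe_mk, one_mul]
      refine (intervalIntegral.norm_integral_le_of_norm_le_const
        (C := ‖f‖) fun v _ => f.norm_coe_le_norm _).trans ?_
      rw [sub_zero, abs_of_nonneg u.2.1]
      exact mul_le_of_le_one_right (norm_nonneg _) u.2.2)

lemma primitiveCLM_apply {E : Type*} [NormedAddCommGroup E] [NormedSpace ℝ E] (f : C(I, E))
    (u : I) : primitiveCLM E f u = ∫ v in (0 : ℝ)..u, IccExtend zero_le_one f v := rfl

end Primitive

/-! ### Smooth local inverses -/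

section LocalInverse

open Set Filter Topology

/-- The inverse function theorem for maps of class `C^∞` on an open set, with an inverse that is
`C^∞` on the whole of its domain (not only at one point, where `C^∞` merely means `C^k` near the
point for each finite `k`). -/
lemma exists_smooth_localInverse {A B : Type*} [NormedAddCommGroup A] [NormedSpace ℝ A]
    [CompleteSpace A] [NormedAddCommGroup B] [NormedSpace ℝ B] {f : A → B} {s : Set A}
    (hs : IsOpen s) (hf : ContDiffOn ℝ ∞ f s) {a : A} (ha : a ∈ s) {e : A ≃L[ℝ] B}
    (he : HasFDerivAt f (e : A →L[ℝ] B) a) :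
    ∃ P : OpenPartialHomeomorph A B, a ∈ P.source ∧ P.source ⊆ s ∧ (∀ x, P x = f x) ∧
      ContDiffOn ℝ ∞ P.symm P.target := by
  have hfa : ContDiffAt ℝ ∞ f a := hf.contDiffAt (hs.mem_nhds ha)
  let P₀ := hfa.toOpenPartialHomeomorph f he (by simp)
  have hs' : IsOpen (s ∩ fderiv ℝ f ⁻¹' range ((↑) : (A ≃L[ℝ] B) → A →L[ℝ] B)) :=
    (hf.continuousOn_fderiv_of_isOpen hs (by simp)).isOpen_inter_preimage hs
      ContinuousLinearEquiv.isOpen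
  refine ⟨P₀.restrOpen _ hs', ?_, ?_, fun x => rfl, ?_⟩
  · rw [OpenPartialHomeomorph.restrOpen_source]
    exact ⟨hfa.mem_toOpenPartialHomeomorph_source he (by simp), ha, e, he.fderiv.symm⟩
  · rw [OpenPartialHomeomorph.restrOpen_source]
    exact fun x hx => hx.2.1
  · intro b hb
    have hb' := (P₀.restrOpen _ hs').map_target hb
    rw [OpenPartialHomeomorph.restrOpen_source] at hb'
    obtain ⟨e', he'⟩ := hb'.2.2
    have hcd := hf.contDiffAt (hs.mem_nhds hb'.2.1)
    refine ((P₀.restrOpen _ hs').contDiffAt_symm hb (f₀' := e') ?_ hcd).contDiffWithinAt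
    rw [he']
    exact (hcd.differentiableAt (by simp)).hasFDerivAt

end LocalInverse

/-! ### Smooth local flows -/

section LocalFlow

open Set Filter Topology unitInterval

universe u

variable {E : Type u} [NormedAddCommGroup E] [NormedSpace ℝ E]

/-- `φ` is a smooth flow of the vector field `X`, for times in the open interval `J ∋ 0` and
initial points in the open set `V`. -/
structure IsLocalFlow (X : E → E) (J : Set ℝ) (V : Set E) (φ : ℝ × E → E) : Prop where
  isOpen_time : IsOpen J
  ordConnected : J.OrdConnected
  zero_mem : (0 : ℝ) ∈ J
  isOpen_space : IsOpen V
  contDiffOn : ContDiffOn ℝ ∞ φ (J ×ˢ V)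
  map_zero : ∀ x ∈ V, φ (0, x) = x
  hasDerivAt : ∀ t ∈ J, ∀ x ∈ V, HasDerivAt (fun s => φ (s, x)) (X (φ (t, x))) t

/-- The linear automorphism `(s, v, h) ↦ (s, v, h - v - s • w)` of `ℝ × E × C(I, E)`. -/
noncomputable def shearEquiv (w : C(I, E)) : (ℝ × E × C(I, E)) ≃L[ℝ] (ℝ × E × C(I, E)) :=
  ContinuousLinearEquiv.equivOfInverse
    ((ContinuousLinearMap.fst ℝ ℝ (E × C(I, E))).prod
      (((ContinuousLinearMap.fst ℝ E C(I, E)).comp (ContinuousLinearMap.snd ℝ ℝ (E × C(I, E)))).prod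
        (((ContinuousLinearMap.snd ℝ E C(I, E)).comp (ContinuousLinearMap.snd ℝ ℝ (E × C(I, E))))
          - (ContinuousLinearMap.const ℝ I).comp
            ((ContinuousLinearMap.fst ℝ E C(I, E)).comp (ContinuousLinearMap.snd ℝ ℝ (E × C(I, E))))
          - (ContinuousLinearMap.fst ℝ ℝ (E × C(I, E))).smulRight w)))
    ((ContinuousLinearMap.fst ℝ ℝ (E × C(I, E))).prod
      (((ContinuousLinearMap.fst ℝ E C(I, E)).comp (ContinuousLinearMap.snd ℝ ℝ (E × C(I, E)))).prod
        (((ContinuousLinearMap.snd ℝ E C(I, E)).comp (ContinuousLinearMap.snd ℝ ℝ (E × C(I, E))))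
          + (ContinuousLinearMap.const ℝ I).comp
            ((ContinuousLinearMap.fst ℝ E C(I, E)).comp (ContinuousLinearMap.snd ℝ ℝ (E × C(I, E))))
          + (ContinuousLinearMap.fst ℝ ℝ (E × C(I, E))).smulRight w)))
    (fun p => by ext <;> simp; abel) (fun p => by ext <;> simp; abel)

/-- The map whose zeros in the last component are the solutions, parametrised by `[0, 1]`, of the
integral equation `f u = x + t ∫₀ᵘ X (f v) dv`, together with the parameters `t` and `x`. -/
noncomputable def integralEquationMap (X : C(E, E)) (p : ℝ × E × C(I, E)) : ℝ × E × C(I, E) :=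
  (p.1, p.2.1, p.2.2 - ContinuousLinearMap.const ℝ I p.2.1 -
    p.1 • primitiveCLM E (X.comp p.2.2))

lemma contDiff_integralEquationMap (X : C(E, E)) (hX : ContDiff ℝ ∞ X) :
    ContDiff ℝ ∞ (integralEquationMap X) := by
  have h1 : ContDiff ℝ ∞ (fun p : ℝ × E × C(I, E) => X.comp p.2.2) :=
    (contDiff_continuousMap_comp X hX).comp (contDiff_snd.comp contDiff_snd)
  have h2 := h1.continuousLinearMap_comp (primitiveCLM E)
  have h3 : ContDiff ℝ ∞ (fun p : ℝ × E × C(I, E) => ContinuousLinearMap.const ℝ I p.2.1) :=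
    (ContinuousLinearMap.const ℝ I (M := E)).contDiff.comp (contDiff_fst.comp contDiff_snd)
  exact contDiff_fst.prodMk ((contDiff_fst.comp contDiff_snd).prodMk
    (((contDiff_snd.comp contDiff_snd).sub h3).sub (contDiff_fst.smul h2)))

lemma hasFDerivAt_integralEquationMap (X : C(E, E)) (hX : ContDiff ℝ ∞ X) (x : E) (f : C(I, E)) :
    HasFDerivAt (integralEquationMap X)
      (shearEquiv (primitiveCLM E (X.comp f)) : (ℝ × E × C(I, E)) →L[ℝ] _) (0, x, f) := by
  have h1 : ContDiff ℝ ∞ (fun p : ℝ × E × C(I, E) => X.comp p.2.2) :=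
    (contDiff_continuousMap_comp X hX).comp (contDiff_snd.comp contDiff_snd)
  have h2 := ((h1.continuousLinearMap_comp (primitiveCLM E)).differentiable (by simp)
    (0, x, f)).hasFDerivAt
  have h3 := (ContinuousLinearMap.const ℝ I (M := E)).hasFDerivAt.comp (0, x, f)
    (hasFDerivAt_fst.comp (0, x, f) (hasFDerivAt_snd (𝕜 := ℝ) (E := ℝ) (F := E × C(I, E))))
  have h4 := (hasFDerivAt_fst (𝕜 := ℝ) (E := ℝ) (F := E × C(I, E)) (p := (0, x, f))).smul h2
  refine ((hasFDerivAt_fst.prodMk ((hasFDerivAt_fst.comp (0, x, f) hasFDerivAt_snd).prodMk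
    (((hasFDerivAt_snd.comp (0, x, f) hasFDerivAt_snd).sub h3).sub h4)))).congr_fderiv ?_
  ext <;> simp [shearEquiv]

/-- A smooth vector field has a smooth local flow near every point: the continuous local flow
given by the Picard-Lindelöf theorem is, after rescaling time to `[0, 1]`, the solution of the
integral equation singled out by the inverse function theorem, and so depends smoothly on the
parameters. -/
theorem exists_isLocalFlow [CompleteSpace E] {X : E → E} (hX : ContDiff ℝ ∞ X) (x₀ : E) :
    ∃ ε > 0, ∃ V, x₀ ∈ V ∧ ∃ φ, IsLocalFlow X (Ioo (-ε) ε) V φ := by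
  let X' : C(E, E) := ⟨X, hX.continuous⟩
  let f₀ : C(I, E) := ContinuousLinearMap.const ℝ I x₀
  obtain ⟨P, haP, -, hP, hPsymm⟩ := exists_smooth_localInverse isOpen_univ
    (contDiff_integralEquationMap X' hX).contDiffOn (mem_univ _)
    (hasFDerivAt_integralEquationMap X' hX x₀ f₀)
  obtain ⟨δ, hδ, hδP⟩ := Metric.isOpen_iff.1 P.open_source _ haP
  obtain ⟨ε, hε, a, r, L, K, hr, hpl⟩ :=
    IsPicardLindelof.of_contDiffAt_one (hX.contDiffAt (x := x₀) |>.of_le (by simp))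
  obtain ⟨α, hα, hαc⟩ :=
    (hpl 0).exists_forall_mem_closedBall_eq_hasDerivWithinAt_continuousOn
  simp only [zero_sub, zero_add] at hα hαc
  have hcont : ContinuousAt α (x₀, 0) := hαc.continuousAt
    (prod_mem_nhds (Metric.closedBall_mem_nhds _ hr) (Icc_mem_nhds (by linarith) hε))
  have hα0 : α (x₀, 0) = x₀ := (hα x₀ (Metric.mem_closedBall_self r.2)).1
  obtain ⟨η, hη, hηα⟩ := Metric.continuousAt_iff.1 hcont (δ / 2) (by positivity)
  rw [hα0] at hηα
  obtain ⟨ρ, hρ, hρδ, hρη, hρε, hρr⟩ : ∃ ρ > 0, ρ ≤ δ ∧ ρ ≤ η ∧ ρ ≤ ε ∧ ρ ≤ r :=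
    ⟨min (min δ η) (min ε r), by positivity, by simp, by simp, by simp, by simp⟩
  have hder : ∀ t ∈ Ioo (-ρ) ρ, ∀ x ∈ Metric.ball x₀ ρ,
      HasDerivAt (fun s => α (x, s)) (X (α (x, t))) t := fun t ht x hx =>
    ((hα x (Metric.ball_subset_closedBall.trans (Metric.closedBall_subset_closedBall hρr) hx)).2 t
      ⟨by linarith [ht.1], by linarith [ht.2]⟩).hasDerivAt
      (Icc_mem_nhds (by linarith [ht.1]) (by linarith [ht.2]))
  refine ⟨ρ, hρ, Metric.ball x₀ ρ, Metric.mem_ball_self hρ, fun p => α (p.2, p.1), isOpen_Ioo,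
    ordConnected_Ioo, ⟨by linarith, hρ⟩, Metric.isOpen_ball, ?_, fun x hx => (hα x
      (Metric.ball_subset_closedBall.trans (Metric.closedBall_subset_closedBall hρr) hx)).1, hder⟩
  -- The rescaled curve `u ↦ α (x, t * u)` solves the integral equation and stays close to the
  -- constant curve `x₀`, hence is the solution found by the local inverse `P.symm`.
  have key : ∀ p ∈ Ioo (-ρ) ρ ×ˢ Metric.ball x₀ ρ, (p.1, p.2, (0 : C(I, E))) ∈ P.target ∧
      α (p.2, p.1) = (P.symm (p.1, p.2, 0)).2.2 1 := by
    rintro ⟨t, x⟩ ⟨ht, hx⟩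
    have htu : ∀ u : ℝ, u ∈ I → t * u ∈ Ioo (-ρ) ρ := fun u hu => by
      refine mem_Ioo.2 (abs_lt.1 ?_)
      rw [abs_mul, abs_of_nonneg hu.1]
      exact (mul_le_of_le_one_right (abs_nonneg t) hu.2).trans_lt (abs_lt.2 ht)
    have hder' : ∀ u ∈ I, HasDerivAt (fun s => α (x, t * s)) (t • X (α (x, t * u))) u :=
      fun u hu => (hder _ (htu u hu) x hx).scomp u (by simpa using (hasDerivAt_id u).const_mul t)
    have hcon : ContinuousOn (fun s => α (x, t * s)) I :=
      fun u hu => (hder' u hu).continuousAt.continuousWithinAt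
    let f : C(I, E) := ⟨fun u => α (x, t * u), hcon.domRestrict⟩
    have hf : ∀ u : I, f u = α (x, t * u) := fun _ => rfl
    have hmem : (t, x, f) ∈ P.source := by
      refine hδP ?_
      simp only [Metric.mem_ball, Prod.dist_eq, max_lt_iff]
      refine ⟨?_, (Metric.mem_ball.1 hx).trans_le hρδ, ?_⟩
      · rw [Real.dist_eq, sub_zero]
        exact (abs_lt.2 ht).trans_le hρδ
      · refine lt_of_le_of_lt ((ContinuousMap.dist_le (by positivity)).2 fun u => ?_)
          (half_lt_self hδ)
        refine (hηα ?_).le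
        simp only [Prod.dist_eq, max_lt_iff, Real.dist_eq, sub_zero]
        exact ⟨(Metric.mem_ball.1 hx).trans_le hρη, (abs_lt.2 (htu u u.2)).trans_le hρη⟩
    have hHf : P (t, x, f) = (t, x, 0) := by
      rw [hP]
      refine Prod.ext rfl (Prod.ext rfl ?_)
      ext u
      simp only [integralEquationMap, ContinuousMap.sub_apply, ContinuousMap.smul_apply,
        primitiveCLM_apply, ContinuousMap.zero_apply]
      have hsub : ∀ v ∈ uIcc (0 : ℝ) u, v ∈ I := fun v hv => by
        rw [uIcc_of_le u.2.1] at hv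
        exact ⟨hv.1, hv.2.trans u.2.2⟩
      have hint : ∫ v in (0 : ℝ)..u, t • X (α (x, t * v)) = α (x, t * u) - α (x, t * 0) := by
        refine intervalIntegral.integral_eq_sub_of_hasDerivAt (fun v hv => hder' v (hsub v hv)) ?_
        refine ContinuousOn.intervalIntegrable ?_
        exact (continuousOn_const.smul (hX.continuous.comp_continuousOn hcon)).mono hsub
      have hint' : ∫ v in (0 : ℝ)..u, IccExtend zero_le_one (X'.comp f) v =
          ∫ v in (0 : ℝ)..u, X (α (x, t * v)) := by
        refine intervalIntegral.integral_congr fun v hv => ?_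
        exact IccExtend_of_mem _ _ (hsub v hv)
      rw [hint', ← intervalIntegral.integral_smul, hint, mul_zero, (hα x
        (Metric.ball_subset_closedBall.trans (Metric.closedBall_subset_closedBall hρr) hx)).1]
      simp [hf]
    refine ⟨hHf ▸ P.map_source hmem, ?_⟩
    rw [← hHf, P.left_inv hmem]
    simp [hf]
  have hsm : ContDiffOn ℝ ∞ (fun p : ℝ × E => ContinuousMap.evalCLM ℝ (1 : I)
      (P.symm (p.1, p.2, (0 : C(I, E)))).2.2) (Ioo (-ρ) ρ ×ˢ Metric.ball x₀ ρ) := by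
    have hin : ContDiff ℝ ∞ (fun p : ℝ × E => (p.1, p.2, (0 : C(I, E)))) :=
      contDiff_fst.prodMk (contDiff_snd.prodMk contDiff_const)
    exact (ContinuousMap.evalCLM ℝ (1 : I)).contDiff.comp_contDiffOn
      ((contDiff_snd.comp contDiff_snd).comp_contDiffOn
        (hPsymm.comp hin.contDiffOn fun p hp => (key p hp).1))
  exact hsm.congr fun p hp => (key p hp).2

end LocalFlow

/-! ### The maximal flow -/

section Flow

open Set Filter Topology

universe u

variable {E : Type u} [NormedAddCommGroup E] [NormedSpace ℝ E]

/-- Two integral curves of a smooth vector field on an interval agree as soon as they agree at one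
time. -/
lemma eqOn_of_hasDerivAt {X : E → E} (hX : ContDiff ℝ ∞ X) {J : Set ℝ} (hJ : IsOpen J)
    (hJc : J.OrdConnected) {c d : ℝ → E} (hc : ∀ t ∈ J, HasDerivAt c (X (c t)) t)
    (hd : ∀ t ∈ J, HasDerivAt d (X (d t)) t) {s : ℝ} (hs : s ∈ J) (h : c s = d s) :
    EqOn c d J := by
  intro t ht
  have key := hJc.isPreconnected.induction₂ (fun a b => c a = d a ↔ c b = d b) (fun a ha => ?_)
    (fun _ _ _ _ _ _ h₁ h₂ => h₁.trans h₂) (fun _ _ _ _ h => h.symm) hs ht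
  · exact key.1 h
  · refine eventually_nhdsWithin_of_eventually_nhds ?_
    by_cases hcd : c a = d a
    · obtain ⟨K, S, hS, hK⟩ := (hX.contDiffAt (x := c a) |>.of_le (by simp)).exists_lipschitzOnWith
      have hJa := hJ.mem_nhds ha
      have heq : c =ᶠ[𝓝 a] d := ODE_solution_unique_of_eventually (v := fun _ => X)
        (s := fun _ => S) (K := K) (Eventually.of_forall fun _ => hK)
        ((eventually_of_mem hJa hc).and ((hc a ha).continuousAt.eventually_mem hS))
        ((eventually_of_mem hJa hd).and ((hd a ha).continuousAt.eventually_mem (hcd ▸ hS))) hcd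
      filter_upwards [heq] with b hb
      exact iff_of_true hcd hb
    · filter_upwards [(hc a ha).continuousAt.ne_iff_eventually_ne (hd a ha).continuousAt |>.1 hcd]
        with b hb
      exact iff_of_false hcd hb

/-- The set of pairs `(t, x)` such that the flow of `X` for time `t` is defined, and smooth, around
the initial point `x`. -/
def flowDomain (X : E → E) : Set (ℝ × E) :=
  {p | ∃ J V φ, IsLocalFlow X J V φ ∧ p.1 ∈ J ∧ p.2 ∈ V}

open Classical in
/-- The flow of `X`, patched together from the local flows; it is `0` outside `flowDomain X`. -/
noncomputable def flow (X : E → E) (p : ℝ × E) : E :=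
  if h : p ∈ flowDomain X then h.choose_spec.choose_spec.choose p else 0

variable {X : E → E} {J : Set ℝ} {V : Set E} {φ : ℝ × E → E}

lemma IsLocalFlow.eqOn_flow (hX : ContDiff ℝ ∞ X) (h : IsLocalFlow X J V φ) :
    EqOn (flow X) φ (J ×ˢ V) := by
  rintro ⟨t, x⟩ ⟨ht, hx⟩
  have hp : (t, x) ∈ flowDomain X := ⟨J, V, φ, h, ht, hx⟩
  rw [flow, dif_pos hp]
  obtain ⟨h', ht', hx'⟩ := hp.choose_spec.choose_spec.choose_spec
  refine eqOn_of_hasDerivAt hX (h'.isOpen_time.inter h.isOpen_time)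
    (h'.ordConnected.inter h.ordConnected)
    (c := fun s => hp.choose_spec.choose_spec.choose (s, x)) (d := fun s => φ (s, x))
    (fun s hs => h'.hasDerivAt s hs.1 x hx') (fun s hs => h.hasDerivAt s hs.2 x hx)
    ⟨h'.zero_mem, h.zero_mem⟩ ?_ ⟨ht', ht⟩
  exact (h'.map_zero x hx').trans (h.map_zero x hx).symm

lemma IsLocalFlow.subset_flowDomain (h : IsLocalFlow X J V φ) : J ×ˢ V ⊆ flowDomain X :=
  fun _ hp => ⟨J, V, φ, h, hp.1, hp.2⟩

lemma isOpen_flowDomain : IsOpen (flowDomain X) := by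
  rw [isOpen_iff_mem_nhds]
  rintro p ⟨J, V, φ, h, hp⟩
  exact mem_of_superset ((h.isOpen_time.prod h.isOpen_space).mem_nhds hp) h.subset_flowDomain

lemma contDiffOn_flow (hX : ContDiff ℝ ∞ X) : ContDiffOn ℝ ∞ (flow X) (flowDomain X) := by
  rintro p ⟨J, V, φ, h, hp⟩
  exact (((h.contDiffOn.congr (h.eqOn_flow hX)) p hp).contDiffAt
    ((h.isOpen_time.prod h.isOpen_space).mem_nhds hp)).contDiffWithinAt

lemma hasDerivAt_flow (hX : ContDiff ℝ ∞ X) {t : ℝ} {x : E} (hp : (t, x) ∈ flowDomain X) :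
    HasDerivAt (fun s => flow X (s, x)) (X (flow X (t, x))) t := by
  obtain ⟨J, V, φ, h, ht, hx⟩ := hp
  have heq := h.eqOn_flow hX
  rw [heq ⟨ht, hx⟩]
  refine (h.hasDerivAt t ht x hx).congr_of_eventuallyEq ?_
  filter_upwards [h.isOpen_time.mem_nhds ht] with s hs
  exact heq ⟨hs, hx⟩

/-- A local flow on `J` can be prolonged, near an initial point whose trajectory at time `t ∈ J`
is in the domain of a local flow with times in `(-ε, ε)`, to the times in `J ∪ (t - ε, t + ε)`. -/
lemma IsLocalFlow.extend (hX : ContDiff ℝ ∞ X) (h : IsLocalFlow X J V φ) {ε : ℝ} (hε : 0 < ε)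
    {W : Set E} {ψ : ℝ × E → E} (h' : IsLocalFlow X (Ioo (-ε) ε) W ψ) {t : ℝ} (ht : t ∈ J)
    {x : E} (hx : x ∈ V) (hxW : φ (t, x) ∈ W) {s : ℝ} (hs : s ∈ Ioo (t - ε) (t + ε)) :
    (s, x) ∈ flowDomain X := by
  classical
  have htI : t ∈ Ioo (t - ε) (t + ε) := ⟨by linarith, by linarith⟩
  have hφt : ContDiffOn ℝ ∞ (fun y => φ (t, y)) V := h.contDiffOn.comp
    (contDiff_const.prodMk contDiff_id).contDiffOn fun y hy => ⟨ht, hy⟩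
  set V' := V ∩ (fun y => φ (t, y)) ⁻¹' W with hV'
  have hshift : ∀ r ∈ Ioo (t - ε) (t + ε), r - t ∈ Ioo (-ε) ε :=
    fun r hr => ⟨by linarith [hr.1], by linarith [hr.2]⟩
  have hder : ∀ r ∈ Ioo (t - ε) (t + ε), ∀ y ∈ V',
      HasDerivAt (fun r => ψ (r - t, φ (t, y))) (X (ψ (r - t, φ (t, y)))) r := fun r hr y hy =>
    (h'.hasDerivAt (r - t) (hshift r hr) _ hy.2).comp_sub_const r t
  -- On the overlap both expressions are integral curves through `φ (t, y)` at time `t`.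
  have hover : ∀ r ∈ J ∩ Ioo (t - ε) (t + ε), ∀ y ∈ V', φ (r, y) = ψ (r - t, φ (t, y)) := by
    intro r hr y hy
    refine eqOn_of_hasDerivAt hX (h.isOpen_time.inter isOpen_Ioo)
      (h.ordConnected.inter ordConnected_Ioo) (c := fun r => φ (r, y))
      (d := fun r => ψ (r - t, φ (t, y))) (fun r hr => h.hasDerivAt r hr.1 y hy.1)
      (fun r hr => hder r hr.2 y hy) ⟨ht, htI⟩ ?_ hr
    simp only [sub_self]
    exact (h'.map_zero _ hy.2).symm
  let θ : ℝ × E → E := fun p => if p.1 ∈ J then φ p else ψ (p.1 - t, φ (t, p.2))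
  have hθ₁ : EqOn θ φ (J ×ˢ V') := fun p hp => if_pos hp.1
  have hθ₂ : EqOn θ (fun p => ψ (p.1 - t, φ (t, p.2))) (Ioo (t - ε) (t + ε) ×ˢ V') := by
    intro p hp
    by_cases hpJ : p.1 ∈ J
    · exact (hθ₁ ⟨hpJ, hp.2⟩).trans (hover _ ⟨hpJ, hp.1⟩ _ hp.2)
    · exact if_neg hpJ
  have hV'o : IsOpen V' := hφt.continuousOn.isOpen_inter_preimage h.isOpen_space h'.isOpen_space
  have hsm : ContDiffOn ℝ ∞ (fun p : ℝ × E => ψ (p.1 - t, φ (t, p.2)))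
      (Ioo (t - ε) (t + ε) ×ˢ V') :=
    h'.contDiffOn.comp ((contDiff_fst.sub contDiff_const).contDiffOn.prodMk
      (hφt.comp contDiff_snd.contDiffOn fun p hp => hp.2.1)) fun p hp => ⟨hshift _ hp.1, hp.2.2⟩
  refine ⟨J ∪ Ioo (t - ε) (t + ε), V', θ, ⟨h.isOpen_time.union isOpen_Ioo, ?_, Or.inl h.zero_mem,
    hV'o, ?_, ?_, ?_⟩, Or.inr hs, hx, hxW⟩
  · exact (IsPreconnected.union t ht htI h.ordConnected.isPreconnected
      isPreconnected_Ioo).ordConnected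
  · rw [union_prod]
    exact ((h.contDiffOn.mono (prod_mono_right inter_subset_left)).congr hθ₁).union_of_isOpen
      (hsm.congr hθ₂) (h.isOpen_time.prod hV'o) (isOpen_Ioo.prod hV'o)
  · exact fun y hy => (hθ₁ ⟨h.zero_mem, hy⟩).trans (h.map_zero y hy.1)
  · rintro r (hr | hr) y hy
    · rw [hθ₁ ⟨hr, hy⟩]
      refine (h.hasDerivAt r hr y hy.1).congr_of_eventuallyEq ?_
      filter_upwards [h.isOpen_time.mem_nhds hr] with q hq
      exact hθ₁ ⟨hq, hy⟩
    · rw [hθ₂ ⟨hr, hy⟩]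
      refine (hder r hr y hy).congr_of_eventuallyEq ?_
      filter_upwards [isOpen_Ioo.mem_nhds hr] with q hq
      exact hθ₂ ⟨hq, hy⟩

/-- An integral curve on an interval around `0` stays in the domain of the flow and is given by
it: whether `(t, c 0)` lies in the domain is locally constant in `t`, since around each point of
the curve there is a local flow with which to prolong. -/
lemma mem_flowDomain_of_hasDerivAt [CompleteSpace E] (hX : ContDiff ℝ ∞ X) {I : Set ℝ}
    (hI : IsOpen I) (hIc : I.OrdConnected) (h0 : (0 : ℝ) ∈ I) {c : ℝ → E}
    (hc : ∀ t ∈ I, HasDerivAt c (X (c t)) t) {t : ℝ} (ht : t ∈ I) :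
    (t, c 0) ∈ flowDomain X ∧ flow X (t, c 0) = c t := by
  have hval : ∀ {J V φ}, IsLocalFlow X J V φ → c 0 ∈ V → ∀ s ∈ J ∩ I, φ (s, c 0) = c s :=
    fun {J V φ} h hV s hs => eqOn_of_hasDerivAt hX (h.isOpen_time.inter hI)
      (h.ordConnected.inter hIc) (c := fun r => φ (r, c 0)) (d := c)
      (fun r hr => h.hasDerivAt r hr.1 _ hV) (fun r hr => hc r hr.2) ⟨h.zero_mem, h0⟩
      (h.map_zero _ hV) hs
  have hmem : (t, c 0) ∈ flowDomain X := by
    have key := hIc.isPreconnected.induction₂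
      (fun a b => (a, c 0) ∈ flowDomain X ↔ (b, c 0) ∈ flowDomain X) (fun a ha => ?_)
      (fun _ _ _ _ _ _ h₁ h₂ => h₁.trans h₂) (fun _ _ _ _ h => h.symm) h0 ht
    · refine key.1 ?_
      obtain ⟨ε, hε, V, hV, φ, h⟩ := exists_isLocalFlow hX (c 0)
      exact h.subset_flowDomain ⟨h.zero_mem, hV⟩
    · obtain ⟨ε, hε, W, hW, ψ, h'⟩ := exists_isLocalFlow hX (c a)
      have hext : ∀ r ∈ I, c r ∈ W → (r, c 0) ∈ flowDomain X → ∀ s, |s - r| < ε →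
          (s, c 0) ∈ flowDomain X := by
        rintro r hr hrW ⟨J, V, φ, h, hrJ, hV⟩ s hs
        rw [abs_lt] at hs
        refine h.extend hX hε h' hrJ hV ?_ ⟨by linarith [hs.1], by linarith [hs.2]⟩
        rw [hval h hV r ⟨hrJ, hr⟩]
        exact hrW
      refine eventually_nhdsWithin_of_eventually_nhds ?_
      filter_upwards [hI.mem_nhds ha, (hc a ha).continuousAt.eventually_mem
        (h'.isOpen_space.mem_nhds hW), Metric.ball_mem_nhds a hε] with b hb hbW hab
      rw [Metric.mem_ball, Real.dist_eq] at hab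
      exact ⟨fun h => hext a ha hW h b hab, fun h => hext b hb hbW h a (abs_sub_comm a b ▸ hab)⟩
  refine ⟨hmem, ?_⟩
  obtain ⟨J, V, φ, h, htJ, hV⟩ := hmem
  rw [h.eqOn_flow hX ⟨htJ, hV⟩, hval h hV t ⟨htJ, ht⟩]

/-- The version of `mem_flowDomain_of_hasDerivAt` with an arbitrary initial time. -/
lemma mem_flowDomain_of_hasDerivAt_sub [CompleteSpace E] (hX : ContDiff ℝ ∞ X) {I : Set ℝ}
    (hI : IsOpen I) (hIc : I.OrdConnected) {c : ℝ → E}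
    (hc : ∀ t ∈ I, HasDerivAt c (X (c t)) t) {s t : ℝ} (hs : s ∈ I) (ht : t ∈ I) :
    (t - s, c s) ∈ flowDomain X ∧ flow X (t - s, c s) = c t := by
  have := mem_flowDomain_of_hasDerivAt hX (I := (fun r => r + s) ⁻¹' I)
    (hI.preimage (by fun_prop)) (hIc.preimage_mono fun a b h => by simpa using h) (by simpa)
    (c := fun r => c (r + s)) (fun r hr => (hc (r + s) hr).comp_add_const r s)
    (t := t - s) (by simpa)
  simpa using this

end Flow

/-! ### Time functions of a vector field -/

section TimeFunction

open Set Filter Topology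

universe u

variable {E : Type u} [NormedAddCommGroup E] [NormedSpace ℝ E]

/-- `τ` is a smooth function on the open set `W` whose derivative along `X` is `1`. -/
structure IsTimeFunctionOn (X : E → E) (W : Set E) (τ : E → ℝ) : Prop where
  isOpen : IsOpen W
  contDiffOn : ContDiffOn ℝ ∞ τ W
  fderiv_apply : ∀ p ∈ W, fderiv ℝ τ p (X p) = 1

/-- Along an integral curve, a time function measures the time up to a constant. -/
lemma IsTimeFunctionOn.exists_eq_add {X : E → E} {W : Set E} {τ : E → ℝ}
    (h : IsTimeFunctionOn X W τ) {I : Set ℝ} (hI : IsOpen I) (hIc : I.OrdConnected) {c : ℝ → E}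
    (hc : ∀ t ∈ I, HasDerivAt c (X (c t)) t) (hW : ∀ t ∈ I, c t ∈ W) :
    ∃ a : ℝ, ∀ t ∈ I, τ (c t) = t + a := by
  have hd : ∀ t ∈ I, HasDerivAt (fun t => τ (c t) - t) 0 t := fun t ht => by
    have h1 : HasFDerivAt τ (fderiv ℝ τ (c t)) (c t) :=
      ((h.contDiffOn.contDiffAt (h.isOpen.mem_nhds (hW t ht))).differentiableAt
        (by simp)).hasFDerivAt
    have h2 := (h1.comp_hasDerivAt t (hc t ht)).sub (hasDerivAt_id t)
    rwa [h.fderiv_apply _ (hW t ht), sub_self] at h2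
  obtain ⟨a, ha⟩ := hI.exists_is_const_of_deriv_eq_zero hIc.isPreconnected
    (fun t ht => (hd t ht).differentiableAt.differentiableWithinAt) (fun t ht => (hd t ht).deriv)
  exact ⟨a, fun t ht => by linarith [ha t ht]⟩

/-- Near a point where `X` does not vanish there is a time function: flowing out of a hyperplane
transverse to `X` gives coordinates in which `X` is constant. -/
lemma exists_isTimeFunctionOn [CompleteSpace E] {X : E → E} (hX : ContDiff ℝ ∞ X) {x₀ : E}
    (hx₀ : X x₀ ≠ 0) : ∃ W τ, x₀ ∈ W ∧ IsTimeFunctionOn X W τ := by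
  obtain ⟨ε, hε, V, hV, φ, hφ⟩ := exists_isLocalFlow hX x₀
  obtain ⟨l, hl⟩ := SeparatingDual.exists_eq_one (R := ℝ) hx₀
  -- `A z = (s, c)` where `z = c + s • X x₀` and `c - x₀` lies in the kernel of `l`.
  let A : E → ℝ × E := fun z => (l (z - x₀), z - l (z - x₀) • X x₀)
  have hA : ContDiff ℝ ∞ A := by
    have : ContDiff ℝ ∞ (fun z => l (z - x₀)) := l.contDiff.comp (contDiff_id.sub contDiff_const)
    exact this.prodMk (contDiff_id.sub (this.smul contDiff_const))
  have hA₀ : A x₀ = (0, x₀) := by simp [A]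
  set S := A ⁻¹' (Ioo (-ε) ε ×ˢ V) with hS
  have hSo : IsOpen S := (isOpen_Ioo.prod hφ.isOpen_space).preimage hA.continuous
  have hS₀ : x₀ ∈ S := by
    rw [hS, mem_preimage, hA₀]
    exact ⟨hφ.zero_mem, hV⟩
  let K : E → E := fun z => φ (A z)
  have hK : ContDiffOn ℝ ∞ K S := hφ.contDiffOn.comp hA.contDiffOn fun z hz => hz
  have hderA : HasFDerivAt A (l.prod (ContinuousLinearMap.id ℝ E - l.smulRight (X x₀))) x₀ := by
    have h1 : HasFDerivAt (fun z => l (z - x₀)) l x₀ :=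
      l.hasFDerivAt.comp x₀ ((hasFDerivAt_id x₀).sub_const x₀)
    exact h1.prodMk ((hasFDerivAt_id x₀).sub (h1.smul_const (X x₀)))
  have hφ₀ : HasFDerivAt φ (fderiv ℝ φ (0, x₀)) (A x₀) := by
    rw [hA₀]
    exact ((hφ.contDiffOn.contDiffAt ((hφ.isOpen_time.prod hφ.isOpen_space).mem_nhds
      ⟨hφ.zero_mem, hV⟩)).differentiableAt (by simp)).hasFDerivAt
  have hφt : fderiv ℝ φ (0, x₀) (1, 0) = X x₀ := by
    have h1 : HasDerivAt (fun s : ℝ => (s, x₀)) (1, 0) 0 :=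
      (hasDerivAt_id (0 : ℝ)).prodMk (hasDerivAt_const _ _)
    have h2 := (hA₀ ▸ hφ₀).comp_hasDerivAt (0 : ℝ) h1
    have h3 := hφ.hasDerivAt 0 hφ.zero_mem x₀ hV
    rw [hφ.map_zero x₀ hV] at h3
    exact h2.unique h3
  have hφx : ∀ v, fderiv ℝ φ (0, x₀) (0, v) = v := by
    intro v
    have h1 : HasFDerivAt (fun x : E => ((0 : ℝ), x)) (ContinuousLinearMap.inr ℝ ℝ E) x₀ :=
      (ContinuousLinearMap.inr ℝ ℝ E).hasFDerivAt
    have h2 := (hA₀ ▸ hφ₀).comp x₀ h1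
    have h3 : HasFDerivAt (φ ∘ fun x : E => ((0 : ℝ), x)) (ContinuousLinearMap.id ℝ E) x₀ := by
      refine (hasFDerivAt_id x₀).congr_of_eventuallyEq ?_
      filter_upwards [hφ.isOpen_space.mem_nhds hV] with x hx
      exact hφ.map_zero x hx
    simpa using congrArg (fun L : E →L[ℝ] E => L v) (h2.unique h3)
  have hderK : HasFDerivAt K (ContinuousLinearEquiv.refl ℝ E : E →L[ℝ] E) x₀ := by
    refine (hφ₀.comp x₀ hderA).congr_fderiv ?_
    ext v
    have : (l v, v - l v • X x₀) = l v • ((1 : ℝ), (0 : E)) + (0, v - l v • X x₀) := by simp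
    simp only [ContinuousLinearMap.comp_apply, ContinuousLinearMap.prod_apply,
      sub_apply, ContinuousLinearMap.id_apply,
      ContinuousLinearMap.smulRight_apply]
    rw [this, map_add, map_smul, hφt, hφx]
    simp
  obtain ⟨P, hP₀, hPS, hPK, hPs⟩ := exists_smooth_localInverse hSo hK hS₀ hderK
  refine ⟨P.target, fun p => l (P.symm p - x₀), ?_, P.open_target, ?_, ?_⟩
  · have := P.map_source hP₀
    rwa [hPK, show K x₀ = x₀ by simp only [K, hA₀, hφ.map_zero x₀ hV]] at this
  · exact l.contDiff.comp_contDiffOn (hPs.sub contDiffOn_const)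
  · intro p hp
    set z := P.symm p with hz
    have hzs : z ∈ P.source := P.map_target hp
    have hKz : K z = p := by rw [← hPK, hz, P.right_inv hp]
    have hτ : HasFDerivAt (fun p => l (P.symm p - x₀))
        (fderiv ℝ (fun p => l (P.symm p - x₀)) p) p :=
      (((l.contDiff.comp_contDiffOn (hPs.sub contDiffOn_const)).contDiffAt
        (P.open_target.mem_nhds hp)).differentiableAt (by simp)).hasFDerivAt
    -- `h ↦ K (z + h • X x₀)` is an integral curve of `X` through `p`, and the time function grows
    -- along it with unit speed.
    have hcurve : HasDerivAt (fun h : ℝ => K (z + h • X x₀)) (X p) 0 := by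
      have hzS := hPS hzs
      have h1 := hφ.hasDerivAt _ hzS.1 _ hzS.2
      have h2 := HasDerivAt.comp_const_add (a := l (z - x₀)) (x := (0 : ℝ))
        (f := fun s => φ (s, (A z).2)) (f' := X (φ ((A z).1, (A z).2))) (by simpa [A] using h1)
      have h3 : φ ((A z).1, (A z).2) = p := hKz
      rw [h3] at h2
      refine h2.congr_of_eventuallyEq (Eventually.of_forall fun h => ?_)
      simp only [K, A]
      congr 2
      · simp [hl, add_sub_right_comm]
      · simp only [add_sub_right_comm z, map_add, map_smul, hl, smul_eq_mul, mul_one, add_smul]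
        abel
    have hcomp := hτ.comp_hasDerivAt_of_eq (0 : ℝ) hcurve (by simp [hKz])
    have hlin : HasDerivAt (fun h : ℝ => l (z - x₀) + h) 1 0 :=
      (hasDerivAt_id (0 : ℝ)).const_add _
    refine hcomp.unique (hlin.congr_of_eventuallyEq ?_)
    have hnear : ∀ᶠ h : ℝ in 𝓝 0, z + h • X x₀ ∈ P.source := by
      have : ContinuousAt (fun h : ℝ => z + h • X x₀) 0 := by fun_prop
      exact this.eventually_mem (P.open_source.mem_nhds (by simpa using hzs))
    filter_upwards [hnear] with h hh
    simp only [Function.comp_apply, ← hPK, P.left_inv hh]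
    simp [hl, add_sub_right_comm]

/-- If the zeros of `X` have empty interior, then `X` has a time function on an open dense set: the
union of a maximal family of disjoint open sets carrying time functions. -/
theorem exists_dense_isTimeFunctionOn [CompleteSpace E] {X : E → E} (hX : ContDiff ℝ ∞ X)
    (hd : Dense {x | X x ≠ 0}) : ∃ U τ, Dense U ∧ IsTimeFunctionOn X U τ := by
  classical
  obtain ⟨M, hM⟩ := zorn_subset
    {S : Set (Set E) | (∀ W ∈ S, ∃ τ, IsTimeFunctionOn X W τ) ∧ S.PairwiseDisjoint id} <| by
      intro C hC hchain
      refine ⟨⋃₀ C, ⟨?_, ?_⟩, fun s hs => subset_sUnion_of_mem hs⟩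
      · rintro W ⟨S, hS, hW⟩
        exact (hC hS).1 W hW
      · exact (pairwiseDisjoint_sUnion hchain.directedOn).2 fun S hS => (hC hS).2
  obtain ⟨⟨hMτ, hMd⟩, hmax⟩ := hM
  choose! σ hσ using hMτ
  let τ : E → ℝ := fun p => if h : ∃ W ∈ M, p ∈ W then σ h.choose p else 0
  have hτ : ∀ W ∈ M, EqOn τ (σ W) W := by
    intro W hW p hp
    have h : ∃ W ∈ M, p ∈ W := ⟨W, hW, hp⟩
    simp only [τ, dif_pos h]
    rw [hMd.elim_set h.choose_spec.1 hW p h.choose_spec.2 hp]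
  have hev : ∀ W ∈ M, ∀ p ∈ W, τ =ᶠ[𝓝 p] σ W := fun W hW p hp =>
    (hτ W hW).eventuallyEq_of_mem ((hσ W hW).isOpen.mem_nhds hp)
  refine ⟨⋃₀ M, τ, ?_, isOpen_sUnion fun W hW => (hσ W hW).isOpen, ?_, ?_⟩
  · by_contra hnd
    obtain ⟨O, hO, hOne, hdisj⟩ : ∃ O : Set E, IsOpen O ∧ O.Nonempty ∧ Disjoint O (⋃₀ M) := by
      refine ⟨(closure (⋃₀ M))ᶜ, isClosed_closure.isOpen_compl, ?_, ?_⟩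
      · rw [nonempty_compl]
        exact fun h => hnd (dense_iff_closure_eq.2 h)
      · exact disjoint_compl_left.mono_right subset_closure
    obtain ⟨p, hpO, hp⟩ := hd.inter_open_nonempty O hO hOne
    obtain ⟨W, σ', hpW, hW⟩ := exists_isTimeFunctionOn hX hp
    have hWO : IsTimeFunctionOn X (W ∩ O) σ' :=
      ⟨hW.isOpen.inter hO, hW.contDiffOn.mono inter_subset_left,
        fun q hq => hW.fderiv_apply q hq.1⟩
    have hins : insert (W ∩ O) M ∈ {S : Set (Set E) | (∀ W ∈ S, ∃ τ, IsTimeFunctionOn X W τ) ∧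
        S.PairwiseDisjoint id} := by
      refine ⟨?_, hMd.insert fun B hB _ => ?_⟩
      · rintro B (rfl | hB)
        · exact ⟨σ', hWO⟩
        · exact ⟨σ B, hσ B hB⟩
      · exact hdisj.mono inter_subset_right (subset_sUnion_of_mem hB)
    have hmem : W ∩ O ∈ M := hmax hins (subset_insert _ _) (mem_insert _ _)
    exact disjoint_left.1 hdisj hpO ⟨W ∩ O, hmem, hpW, hpO⟩
  · rintro p ⟨W, hW, hp⟩
    exact (((hσ W hW).contDiffOn.contDiffAt ((hσ W hW).isOpen.mem_nhds hp)).congr_of_eventuallyEq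
      (hev W hW p hp)).contDiffWithinAt
  · rintro p ⟨W, hW, hp⟩
    rw [(hev W hW p hp).fderiv_eq]
    exact (hσ W hW).fderiv_apply p hp

end TimeFunction

/-! ### Countably many copies of a vector space inside its coordinate space -/

section Coding

open Set

/-- The map `ℝ → ℝ` that stretches each interval `(j, j + 1)`, `j ∈ ℕ`, diffeomorphically onto the
line. Its other values are irrelevant. -/
noncomputable def stretch (r : ℝ) : ℝ := Real.tan (Real.pi * (r - ⌊r⌋₊ - 1 / 2))

lemma natFloor_eq_of_mem_Ioo {j : ℕ} {r : ℝ} (hr : r ∈ Ioo (j : ℝ) (j + 1)) : ⌊r⌋₊ = j :=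
  (Nat.floor_eq_iff (j.cast_nonneg.trans hr.1.le)).2 ⟨hr.1.le, hr.2⟩

lemma contDiffOn_stretch (j : ℕ) : ContDiffOn ℝ ∞ stretch (Ioo (j : ℝ) (j + 1)) := by
  have h : ContDiffOn ℝ ∞ (fun r : ℝ => Real.tan (Real.pi * (r - j - 1 / 2)))
      (Ioo (j : ℝ) (j + 1)) := by
    intro r hr
    have hcos : Real.cos (Real.pi * (r - j - 1 / 2)) ≠ 0 := by
      refine (Real.cos_pos_of_mem_Ioo ⟨?_, ?_⟩).ne' <;> nlinarith [Real.pi_pos, hr.1, hr.2]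
    have h1 : ContDiff ℝ ∞ (fun r : ℝ => Real.pi * (r - j - 1 / 2)) := by fun_prop
    exact ((Real.contDiffAt_tan.2 hcos).comp r h1.contDiffAt).contDiffWithinAt
  refine h.congr fun r hr => ?_
  rw [stretch, natFloor_eq_of_mem_Ioo hr]

lemma exists_stretch_eq (j : ℕ) (a : ℝ) : ∃ r ∈ Ioo (j : ℝ) (j + 1), stretch r = a := by
  have hmem : (j : ℝ) + 1 / 2 + Real.arctan a / Real.pi ∈ Ioo (j : ℝ) (j + 1) := by
    have h1 : -(1 / 2) < Real.arctan a / Real.pi := by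
      rw [lt_div_iff₀ Real.pi_pos]; linarith [Real.neg_pi_div_two_lt_arctan a]
    have h2 : Real.arctan a / Real.pi < 1 / 2 := by
      rw [div_lt_iff₀ Real.pi_pos]; linarith [Real.arctan_lt_pi_div_two a]
    constructor <;> linarith
  refine ⟨_, hmem, ?_⟩
  rw [stretch, natFloor_eq_of_mem_Ioo hmem,
    show Real.pi * ((j : ℝ) + 1 / 2 + Real.arctan a / Real.pi - j - 1 / 2) = Real.arctan a by
      field_simp [Real.pi_ne_zero]; ring, Real.tan_arctan]

/-- The part of `ℝ^ι` where the coordinate `i` lies in `(j, j + 1)`. -/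
def slab {ι : Type*} (i : ι) (j : ℕ) : Set (ι → ℝ) := {k | k i ∈ Ioo (j : ℝ) (j + 1)}

lemma isOpen_slab {ι : Type*} (i : ι) (j : ℕ) : IsOpen (slab i j) :=
  isOpen_Ioo.preimage (continuous_apply i)

/-- The map `ℝ^ι → ℝ^ι` that stretches each slab `slab i j` onto the whole space. -/
noncomputable def decode {ι : Type*} [DecidableEq ι] (i : ι) (k : ι → ℝ) : ι → ℝ :=
  Function.update k i (stretch (k i))

lemma contDiffOn_decode {ι : Type*} [Fintype ι] [DecidableEq ι] (i : ι) (j : ℕ) :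
    ContDiffOn ℝ ∞ (decode i) (slab i j) := by
  rw [contDiffOn_pi]
  intro l
  by_cases hl : l = i
  · subst hl
    refine ((contDiffOn_stretch j).comp (contDiff_apply ℝ ℝ l).contDiffOn
      fun k hk => hk).congr fun k _ => ?_
    simp [decode]
  · refine (contDiff_apply ℝ ℝ l).contDiffOn.congr fun k _ => ?_
    simp [decode, hl]

lemma exists_decode_eq {ι : Type*} [DecidableEq ι] (i : ι) (j : ℕ) (μ : ι → ℝ) :
    ∃ k ∈ slab i j, decode i k = μ := by
  obtain ⟨r, hr, hrμ⟩ := exists_stretch_eq j (μ i)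
  refine ⟨Function.update μ i r, by simpa [slab] using hr, ?_⟩
  simp [decode, hrμ]

end Coding

/-! ### The superposition rule -/

section Superposition

open Set Filter Topology TopologicalSpace

variable {n : ℕ}

/-- The vector field on `ℝⁿ × ℝⁿ` of the first-order system `ẋ = v`, `v̇ = F x v`. -/
def sodeField (F : (Fin n → ℝ) → (Fin n → ℝ) → (Fin n → ℝ))
    (p : (Fin n → ℝ) × (Fin n → ℝ)) : (Fin n → ℝ) × (Fin n → ℝ) :=
  (p.2, F p.1 p.2)

variable {F : (Fin n → ℝ) → (Fin n → ℝ) → (Fin n → ℝ)}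

lemma contDiff_sodeField (hF : ContDiff ℝ ∞ (fun p : (Fin n → ℝ) × (Fin n → ℝ) => F p.1 p.2)) :
    ContDiff ℝ ∞ (sodeField F) :=
  contDiff_snd.prodMk hF

lemma dense_sodeField_ne_zero [NeZero n] : Dense {p | sodeField F p ≠ 0} := by
  have h : Dense ((univ : Set (Fin n → ℝ)) ×ˢ ({0}ᶜ : Set (Fin n → ℝ))) :=
    dense_univ.prod (dense_compl_singleton 0)
  exact h.mono fun p hp h0 => hp.2 (congrArg Prod.fst h0)

lemma IsSODESolutionOn.hasDerivAt_lift {x : ℝ → Fin n → ℝ} {I : Set ℝ}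
    (h : IsSODESolutionOn (fun _ => F) x I) :
    ∀ t ∈ I, HasDerivAt (fun t => (x t, deriv x t)) (sodeField F (x t, deriv x t)) t :=
  fun t ht => (h t ht).1.hasDerivAt.prodMk (h t ht).2

lemma isSODESolutionOn_of_hasDerivAt {x : ℝ → Fin n → ℝ} {I : Set ℝ} (hI : IsOpen I)
    {c : ℝ → (Fin n → ℝ) × (Fin n → ℝ)} (hc : ∀ t ∈ I, HasDerivAt c (sodeField F (c t)) t)
    (hx : ∀ t ∈ I, x t = (c t).1) : IsSODESolutionOn (fun _ => F) x I := by
  have h1 : ∀ t ∈ I, HasDerivAt x (c t).2 t := fun t ht =>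
    (hasFDerivAt_fst.comp_hasDerivAt t (hc t ht)).congr_of_eventuallyEq
      (eventually_of_mem (hI.mem_nhds ht) hx)
  intro t ht
  refine ⟨(h1 t ht).differentiableAt, ?_⟩
  rw [hx t ht, (h1 t ht).deriv]
  exact (hasFDerivAt_snd.comp_hasDerivAt t (hc t ht)).congr_of_eventuallyEq
    (eventually_of_mem (hI.mem_nhds ht) fun s hs => (h1 s hs).deriv)

lemma admitsSuperpositionRule_dim_zero (F : (Fin 0 → ℝ) → (Fin 0 → ℝ) → (Fin 0 → ℝ)) :
    AdmitsSuperpositionRule (fun _ : ℝ => F) :=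
  ⟨0, univ, univ, fun _ => 0, isOpen_univ, dense_univ, isOpen_univ, contDiffOn_const,
    fun _ _ _ _ _ => ⟨0, fun _ _ => ⟨mem_univ _, Subsingleton.elim _ _⟩⟩,
    fun _ _ h _ _ => isSODESolutionOn_of_hasDerivAt h.isOpen (c := fun _ => 0)
      (fun _ _ => (hasDerivAt_const _ _).congr_deriv (Subsingleton.elim _ _))
      fun _ _ => Subsingleton.elim _ _⟩

/-- `T ℝ^{mn}` for `m = 1` is `ℝⁿ × ℝⁿ`. -/
def tangentPowerOne (n : ℕ) : TangentPower n 1 ≃L[ℝ] (Fin n → ℝ) × (Fin n → ℝ) :=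
  (ContinuousLinearEquiv.funUnique (Fin 1) ℝ (Fin n → ℝ)).prodCongr
    (ContinuousLinearEquiv.funUnique (Fin 1) ℝ (Fin n → ℝ))

end Superposition

theorem mainTheorem7 (n : ℕ) (F : (Fin n → ℝ) → (Fin n → ℝ) → (Fin n → ℝ))
    (hF : ContDiff ℝ ∞ (fun p : (Fin n → ℝ) × (Fin n → ℝ) => F p.1 p.2)) :
    AdmitsSuperpositionRule (fun _ : ℝ => F) := by
  rcases Nat.eq_zero_or_pos n with rfl | hn
  · exact admitsSuperpositionRule_dim_zero F
  have : NeZero n := ⟨hn.ne'⟩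
  have hX := contDiff_sodeField hF
  set X := sodeField F
  obtain ⟨U, τ, hU, hτ⟩ := exists_dense_isTimeFunctionOn hX dense_sodeField_ne_zero
  let π := tangentPowerOne n
  let i : Fin (2 * n) := ⟨0, by omega⟩
  let L : (Fin (2 * n) → ℝ) ≃L[ℝ] (Fin n → ℝ) × (Fin n → ℝ) :=
    ContinuousLinearEquiv.ofFinrankEq (by simp [two_mul])
  let q : ℕ → ℝ := TopologicalSpace.denseSeq ℝ
  -- In the `j`-th slab the constants encode the initial condition at the instant where the time
  -- function has the value `q j`.
  let G : ℕ → TangentPower n 1 × (Fin (2 * n) → ℝ) → ℝ × ((Fin n → ℝ) × (Fin n → ℝ)) :=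
    fun j z => (τ (π z.1) - q j, L (decode i z.2))
  let A : ℕ → Set (TangentPower n 1 × (Fin (2 * n) → ℝ)) := fun j => (π ⁻¹' U) ×ˢ slab i j
  let D : Set (TangentPower n 1 × (Fin (2 * n) → ℝ)) := ⋃ j, A j ∩ G j ⁻¹' flowDomain X
  let Ψ : TangentPower n 1 × (Fin (2 * n) → ℝ) → Fin n → ℝ :=
    fun z => (flow X (G ⌊z.2 i⌋₊ z)).1
  have hUo : IsOpen (π ⁻¹' U) := hτ.isOpen.preimage π.continuous
  have hA : ∀ j, IsOpen (A j) := fun j => hUo.prod (isOpen_slab i j)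
  have hG : ∀ j, ContDiffOn ℝ ∞ (G j) (A j) := fun j =>
    ((hτ.contDiffOn.comp (π.contDiff.comp contDiff_fst).contDiffOn fun z hz => hz.1).sub
      contDiffOn_const).prodMk
      (L.contDiff.comp_contDiffOn ((contDiffOn_decode i j).comp contDiff_snd.contDiffOn
        fun z hz => hz.2))
  have hAG : ∀ j, IsOpen (A j ∩ G j ⁻¹' flowDomain X) := fun j =>
    (hG j).continuousOn.isOpen_inter_preimage (hA j) isOpen_flowDomain
  have hΨ : ∀ j, ∀ z ∈ A j, Ψ z = (flow X (G j z)).1 := fun j z hz => by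
    simp only [Ψ, natFloor_eq_of_mem_Ioo hz.2]
  -- Along a generic solution the time function is the time up to a constant.
  have htime : ∀ (I : Set ℝ) (x : Fin 1 → ℝ → Fin n → ℝ),
      IsGenericFamily (fun _ => F) (π ⁻¹' U) I x →
      ∃ a : ℝ, ∀ t ∈ I, τ (π (familyLift x t)) = t + a := fun I x hx =>
    hτ.exists_eq_add hx.isOpen hx.ordConnected (hx.solution 0).hasDerivAt_lift hx.lift_mem
  refine ⟨1, π ⁻¹' U, D, Ψ, hUo, ?_, isOpen_iUnion hAG, ?_, ?_, ?_⟩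
  · exact hU.preimage π.toHomeomorph.isOpenMap
  · rintro z ⟨_, ⟨j, rfl⟩, hz⟩
    have h1 : ContDiffOn ℝ ∞ (fun z => (flow X (G j z)).1) (A j ∩ G j ⁻¹' flowDomain X) :=
      contDiff_fst.comp_contDiffOn ((contDiffOn_flow hX).comp ((hG j).mono Set.inter_subset_left)
        fun z hz => hz.2)
    exact ((h1.congr fun z hz => hΨ j z hz.1) z hz |>.contDiffAt
      ((hAG j).mem_nhds hz)).contDiffWithinAt
  · intro I x hx y hy
    obtain ⟨a, ha⟩ := htime I x hx
    -- The density of `q` provides an instant `q j - a` at which `y` is defined.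
    obtain ⟨_, hs, j, rfl⟩ := (TopologicalSpace.denseRange_denseSeq ℝ).inter_open_nonempty
      ((fun s => s - a) ⁻¹' I) (hx.isOpen.preimage (by fun_prop))
      ⟨a, by simpa using hx.zero_mem⟩
    change q j - a ∈ I at hs
    obtain ⟨k, hk, hkμ⟩ := exists_decode_eq i j
      (L.symm (y (q j - a), deriv y (q j - a)))
    refine ⟨k, fun t ht => ?_⟩
    obtain ⟨h1, h2⟩ := mem_flowDomain_of_hasDerivAt_sub hX hx.isOpen hx.ordConnected
      hy.hasDerivAt_lift hs ht
    have hAm : (familyLift x t, k) ∈ A j := ⟨hx.lift_mem t ht, hk⟩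
    have hGv : G j (familyLift x t, k) =
        (t - (q j - a), (y (q j - a), deriv y (q j - a))) := by
      simp only [G, ha t ht, hkμ, L.apply_symm_apply]
      congr 1
      ring
    refine ⟨Set.mem_iUnion.2 ⟨j, hAm, ?_⟩, ?_⟩
    · rw [Set.mem_preimage, hGv]
      exact h1
    · rw [hΨ j _ hAm, hGv, h2]
  · intro I x hx k hk
    obtain ⟨a, ha⟩ := htime I x hx
    have hkA : ∀ t ∈ I, (familyLift x t, k) ∈ A ⌊k i⌋₊ ∧
        (t + (a - q ⌊k i⌋₊), L (decode i k)) ∈ flowDomain X ∧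
        Ψ (familyLift x t, k) = (flow X (t + (a - q ⌊k i⌋₊), L (decode i k))).1 := by
      intro t ht
      obtain ⟨j, hjA, hj⟩ := Set.mem_iUnion.1 (hk t ht)
      obtain rfl := natFloor_eq_of_mem_Ioo hjA.2
      have hGv : G ⌊k i⌋₊ (familyLift x t, k) =
          (t + (a - q ⌊k i⌋₊), L (decode i k)) := by
        simp only [G, ha t ht, add_sub_assoc]
      exact ⟨hjA, hGv ▸ hj, by rw [hΨ _ _ hjA, hGv]⟩
    refine isSODESolutionOn_of_hasDerivAt hx.isOpen
      (c := fun t => flow X (t + (a - q ⌊k i⌋₊), L (decode i k))) (fun t ht => ?_)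
      fun t ht => (hkA t ht).2.2
    exact (hasDerivAt_flow hX (hkA t ht).2.1).comp_add_const t _
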